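/- Identify the plane $\mathbb{R}^2$ with $\mathbb{C}$. \emph{Gasket construction.} Let $a \in (0,1)$. A horizontal rhombus is a closed filled rhombus with horizontal and vertical diagonals whose height is $a$ times its width; a vertical rhombus is one whose width is $a$ times its height. Start with the interior of the horizontal rhombus of height $2$ and width $2/a$ centered at the origin. At each iteration $k \ge 1$, place into the closure of each current region the largest possible rhombus, vertical if $k$ is odd and horizontal if $k$ is even; the connected components of what remains of each region after removing its rhombus are the regions after iteration $k$, and their closures are the empty polygons at iteration $k$. Let $F^a_k$ be the union of the (closed, filled) empty polygons at iteration $k$, and put $F^a = \bigcap_{k\ge 1} F^a_k$. \emph{Koch snowflake.} Let $g_0 : [0,1] \to \mathbb{R}^2$ be the constant-speed counterclockwise parametrization, starting at $(0,1)$, of the equilateral triangle centered at the origin with one vertex at $(0,1)$. Given the closed polygonal curve $g_k$ with $3\cdot 4^k$ sides of equal length, the polygonal curve $g_{k+1}$ is obtained by replacing the middle third of each side by two segments of the length of that third, forming a spike that points toward the exterior of the curve; $g_k$ has constant speed and maps $0, 1/(3\cdot 4^k), 2/(3\cdot 4^k), \dots, 1$ to the consecutive vertices of its polygon. \textbf{Theorem.}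 The curves $g_k$ converge uniformly on $[0,1]$ to a continuous curve $g$ (the Koch snowflake curve), and if $a = 1/\sqrt{3}$, then $F^a = g([0,1])$. -/

import Mathlib

/-! The Euclidean plane is identified with the complex plane: the point `(x, y)` is `x + y i`. -/

noncomputable section

namespace Gasket

/-- The closed filled horizontal rhombus of aspect ratio `1 : a` with center `c` and
half-height `r` (so its half-width is `r / a`). -/
def horizontalRhombus (a : ℝ) (c : ℂ) (r : ℝ) : Set ℂ :=
  {z | a * |z.re - c.re| + |z.im - c.im| ≤ r}

/-- The closed filled vertical rhombus of aspect ratio `a : 1` with center `c` and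
half-width `r` (so its half-height is `r / a`): a horizontal rhombus turned by 90 degrees. -/
def verticalRhombus (a : ℝ) (c : ℂ) (r : ℝ) : Set ℂ :=
  {z | |z.re - c.re| + a * |z.im - c.im| ≤ r}

/-- The rhombi that are inserted at iteration `k`: vertical for odd `k`, horizontal for even `k`. -/
def rhombus (a : ℝ) (k : ℕ) (c : ℂ) (r : ℝ) : Set ℂ :=
  if Odd k then verticalRhombus a c r else horizontalRhombus a c r

/-- `R` is a largest rhombus, among those with the orientation of iteration `k`, that is contained
in the closed set `P`. All rhombi of one orientation are homothetic, so the size `r` orders them. -/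
def IsLargestRhombus (a : ℝ) (k : ℕ) (P R : Set ℂ) : Prop :=
  ∃ (c : ℂ) (r : ℝ), 0 < r ∧ R = rhombus a k c r ∧ R ⊆ P ∧
    ∀ (c' : ℂ) (r' : ℝ), 0 < r' → rhombus a k c' r' ⊆ P → r' ≤ r

/-- The interiors of the empty polygons at iteration `k`. At the start the empty space is the
interior of the horizontal rhombus of height `2` and width `2 / a` centered at the origin. At
iteration `k + 1` a largest rhombus of the right orientation is placed into each (closed) empty
polygon; the pieces into which it splits the empty space there are the new empty regions. -/
def emptyRegions (a : ℝ) : ℕ → Set (Set ℂ)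
  | 0 => {interior (horizontalRhombus a 0 1)}
  | k + 1 => {V | ∃ U ∈ emptyRegions a k, ∃ R, IsLargestRhombus a (k + 1) (closure U) R ∧
      ∃ z ∈ U \ R, V = connectedComponentIn (U \ R) z}

/-- The union of all closed filled empty polygons at iteration `k`. -/
def stage (a : ℝ) (k : ℕ) : Set ℂ :=
  ⋃ U ∈ emptyRegions a k, closure U

/-- The set produced by the gasket construction with aspect ratio `a`. -/
def gasket (a : ℝ) : Set ℂ :=
  ⋂ (k : ℕ) (_ : 1 ≤ k), stage a k

/-- The `j`-th vertex of the `k`-th Koch polygon, listed counterclockwise and periodic in `j` with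
period `3 * 4 ^ k`. Polygon `0` is the equilateral triangle centered at the origin with a vertex at
`(0, 1)`. In the next polygon, the side from `p` to `q` has its middle third replaced by two sides
of an equilateral triangle; turning `q - p` clockwise by 60 degrees makes this spike point to the
right of the direction of travel, which is the exterior. -/
def kochVertex : ℕ → ℕ → ℂ
  | 0, j => Complex.I * Complex.exp (2 * Real.pi / 3 * Complex.I) ^ j
  | k + 1, j =>
    let p := kochVertex k (j / 4)
    let q := kochVertex k (j / 4 + 1)
    match j % 4 with
    | 0 => p
    | 1 => p + (q - p) / 3
    | 2 => p + (q - p) / 3 + Complex.exp (-(Real.pi / 3 * Complex.I)) * ((q - p) / 3)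
    | _ => p + 2 * (q - p) / 3

/-- The constant-speed closed curve on `[0, 1]` tracing the `k`-th Koch polygon: it maps
`j / (3 * 4 ^ k)` to the `j`-th vertex and is affine between consecutive inputs of this form. -/
def kochPolygon (k : ℕ) (t : ℝ) : ℂ :=
  let s : ℝ := 3 * 4 ^ k * t
  let j : ℕ := ⌊s⌋₊
  kochVertex k j + ((s - j : ℝ) : ℂ) * (kochVertex k (j + 1) - kochVertex k j)

end Gasket

end

noncomputable section

namespace Gasket

open Filter Topology Set

/-! A Koch step factors into two half-steps. Each half-step replaces every side by two sides shorter
by the factor `√3`, with the apex on the right at even levels and on the left at odd ones. The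
resulting `kochHalf n` has `3 * 2 ^ n` sides per period, and `kochHalf (2 * k)` is the `k`-th Koch
polygon (`kochVertex_eq_kochHalf`).

For `a = 1 / √3` the gasket scales by the same factor. All rhombi have angles of 60 and 120 degrees,
and up to similarity only three regions occur: the initial rhombus splits into two darts, a dart
into two right triangles with a 30 degree angle, and such a triangle into a triangle and a dart.

The two recursions run in parallel. Each of the `2 ^ n` regions of iteration `n` carries three
consecutive sides of `kochHalf n`; when it splits, the six refined sides are shared out three and
three (`IsRegionCell.exists_children`, `exists_cells`). The ends of this arc lie in the closed
region, whose size is of order `(1 / √3) ^ n` (`IsRegionCell.closure_spec`).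

Hence every gasket point is a limit of Koch vertices and lies in the compact range of `g`.
Conversely, each `g t` is a limit of arc ends, which lie in the closed decreasing stages. The curve
`g` exists because consecutive polygons differ uniformly by a multiple of `(1 / 3) ^ k`. -/

/-! ### The Koch polygons, refined by one factor `√3` at a time -/

/-- The apex over the unit segment that splits it into two segments of length `1 / √3`, to the
right of the direction of travel for even `n` and to the left for odd `n`. -/
def splitPoint (n : ℕ) : ℂ := ⟨1 / 2, if Odd n then √3 / 6 else -(√3 / 6)⟩

/-- The binary refinement of the Koch polygons: level `2 * k` is the `k`-th Koch polygon. -/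
def kochHalf : ℕ → ℕ → ℂ
  | 0, j => kochVertex 0 j
  | n + 1, j =>
    if j % 2 = 0 then kochHalf n (j / 2)
    else kochHalf n (j / 2) + splitPoint n * (kochHalf n (j / 2 + 1) - kochHalf n (j / 2))

theorem kochHalf_two_mul (n j : ℕ) : kochHalf (n + 1) (2 * j) = kochHalf n j := by
  simp [kochHalf]

theorem kochHalf_two_mul_add_one (n j : ℕ) : kochHalf (n + 1) (2 * j + 1) =
    kochHalf n j + splitPoint n * (kochHalf n (j + 1) - kochHalf n j) := by
  have h1 : (2 * j + 1) % 2 = 1 := by omega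
  have h2 : (2 * j + 1) / 2 = j := by omega
  simp [kochHalf, h1, h2]

theorem sqrt_three_mul_self : √3 * √3 = 3 := Real.mul_self_sqrt (by norm_num)

theorem splitPoint_even (k : ℕ) : splitPoint (2 * k) = ⟨1 / 2, -(√3 / 6)⟩ := by
  simp [splitPoint]

theorem splitPoint_odd (k : ℕ) : splitPoint (2 * k + 1) = ⟨1 / 2, √3 / 6⟩ := by
  simp [splitPoint]

theorem exp_neg_pi_div_three :
    Complex.exp (-(Real.pi / 3 * Complex.I)) = ⟨1 / 2, -(√3 / 2)⟩ := by
  have : -((Real.pi : ℂ) / 3 * Complex.I) = ((-(Real.pi / 3) : ℝ) : ℂ) * Complex.I := by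
    push_cast; ring
  rw [this, Complex.exp_mul_I, ← Complex.ofReal_cos, ← Complex.ofReal_sin, Real.cos_neg,
    Real.sin_neg, Real.cos_pi_div_three, Real.sin_pi_div_three]
  apply Complex.ext <;> simp

/-- The right apex with base angles of 30 degrees is the tip of the Koch spike. The left apexes over
the two legs then fall back onto the original side, at its thirds. -/
theorem kochVertex_eq_kochHalf (k j : ℕ) : kochVertex k j = kochHalf (2 * k) j := by
  induction k generalizing j with
  | zero => rfl
  | succ k ih =>
    have h3 := sqrt_three_mul_self
    have hj := Nat.div_add_mod j 4
    have hlt := Nat.mod_lt j (show 0 < 4 by norm_num)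
    have hk : 2 * (k + 1) = 2 * k + 1 + 1 := by ring
    rw [hk]
    generalize j / 4 = i at hj
    generalize j % 4 = r at hj hlt
    subst hj
    have hdiv : (4 * i + r) / 4 = i := by omega
    have hmod : (4 * i + r) % 4 = r := by omega
    have hp := ih i
    have hq := ih (i + 1)
    simp only [kochVertex, hdiv, hmod, hp, hq]
    generalize hP : kochHalf (2 * k) i = p at *
    generalize hQ : kochHalf (2 * k) (i + 1) = q at *
    have hm : kochHalf (2 * k + 1) (2 * i + 1) = p + splitPoint (2 * k) * (q - p) := by
      rw [kochHalf_two_mul_add_one, hP, hQ]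
    have he0 : kochHalf (2 * k + 1) (2 * i) = p := by rw [kochHalf_two_mul, hP]
    have he1 : kochHalf (2 * k + 1) (2 * i + 1 + 1) = q := by
      rw [show 2 * i + 1 + 1 = 2 * (i + 1) by ring, kochHalf_two_mul, hQ]
    rw [splitPoint_even] at hm
    interval_cases r
    · rw [show 4 * i + 0 = 2 * (2 * i) by ring, kochHalf_two_mul, he0]
      rfl
    · rw [show 4 * i + 1 = 2 * (2 * i) + 1 by ring, kochHalf_two_mul_add_one, hm, he0,
        splitPoint_odd]
      apply Complex.ext <;> simp <;> grind
    · rw [show 4 * i + 2 = 2 * (2 * i + 1) by ring, kochHalf_two_mul, hm, exp_neg_pi_div_three]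
      apply Complex.ext <;> simp <;> grind
    · rw [show 4 * i + 3 = 2 * (2 * i + 1) + 1 by ring, kochHalf_two_mul_add_one, hm, he1,
        splitPoint_odd]
      apply Complex.ext <;> simp <;> grind

theorem norm_splitPoint (n : ℕ) : ‖splitPoint n‖ = 1 / √3 := by
  have h3 := sqrt_three_mul_self
  rw [Complex.norm_eq_sqrt_sq_add_sq, ← Real.sqrt_one, ← Real.sqrt_div (by norm_num)]
  congr 1
  unfold splitPoint
  split_ifs <;> simp <;> grind

theorem norm_one_sub_splitPoint (n : ℕ) : ‖1 - splitPoint n‖ = 1 / √3 := by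
  have h3 := sqrt_three_mul_self
  rw [Complex.norm_eq_sqrt_sq_add_sq, ← Real.sqrt_one, ← Real.sqrt_div (by norm_num)]
  congr 1
  unfold splitPoint
  split_ifs <;> simp <;> grind

theorem norm_kochHalf_zero_le (j : ℕ) : ‖kochHalf 0 (j + 1) - kochHalf 0 j‖ ≤ 2 := by
  have h : ∀ j, ‖kochHalf 0 j‖ = 1 := by
    intro j
    have : (2 * Real.pi / 3 * Complex.I : ℂ) = ((2 * Real.pi / 3 : ℝ) : ℂ) * Complex.I := by
      push_cast; ring
    simp [kochHalf, kochVertex, this, Complex.norm_exp_ofReal_mul_I]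
  calc _ ≤ _ := norm_sub_le _ _
    _ = 2 := by rw [h, h]; norm_num

theorem norm_kochHalf_sub_le (n j : ℕ) :
    ‖kochHalf n (j + 1) - kochHalf n j‖ ≤ 2 * (1 / √3) ^ n := by
  induction n generalizing j with
  | zero => simpa using norm_kochHalf_zero_le j
  | succ n ih =>
    obtain ⟨i, rfl | rfl⟩ := Nat.even_or_odd' j
    · rw [kochHalf_two_mul_add_one, kochHalf_two_mul, add_sub_cancel_left, norm_mul,
        norm_splitPoint, pow_succ]
      have := mul_le_mul_of_nonneg_left (ih i) (show 0 ≤ 1 / √3 by positivity)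
      linarith
    · rw [show 2 * i + 1 + 1 = 2 * (i + 1) by ring, kochHalf_two_mul, kochHalf_two_mul_add_one,
        show ∀ p q s : ℂ, q - (p + s * (q - p)) = (1 - s) * (q - p) by intros; ring, norm_mul,
        norm_one_sub_splitPoint, pow_succ]
      have := mul_le_mul_of_nonneg_left (ih i) (show 0 ≤ 1 / √3 by positivity)
      linarith

theorem norm_kochVertex_sub_le (k j : ℕ) :
    ‖kochVertex k (j + 1) - kochVertex k j‖ ≤ 2 * (1 / 3) ^ k := by
  have h := norm_kochHalf_sub_le (2 * k) j
  rw [pow_mul, div_pow, sq, sq, sqrt_three_mul_self, one_mul] at h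
  simpa [kochVertex_eq_kochHalf] using h

theorem kochVertex_succ_four_mul (k j : ℕ) : kochVertex (k + 1) (4 * j) = kochVertex k j := by
  simp [kochVertex]

theorem kochVertex_add_pow_mul (k m j : ℕ) :
    kochVertex (k + m) (4 ^ m * j) = kochVertex k j := by
  induction m with
  | zero => simp
  | succ m ih => rw [← add_assoc, pow_succ', mul_assoc, kochVertex_succ_four_mul, ih]

/-! ### Uniform convergence to the Koch curve -/

theorem dist_kochVertex_succ_le (k i r : ℕ) (hr : r ≤ 4) :
    dist (kochVertex (k + 1) (4 * i + r)) (kochVertex k i) ≤ 8 * (1 / 3) ^ k := by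
  have h : ∀ r, dist (kochVertex (k + 1) (4 * i + r)) (kochVertex k i) ≤
      r * (2 * (1 / 3) ^ (k + 1)) := by
    intro r
    induction r with
    | zero => simp [kochVertex_succ_four_mul]
    | succ r ih =>
      have := norm_kochVertex_sub_le (k + 1) (4 * i + r)
      rw [← dist_eq_norm] at this
      have h2 := dist_triangle (kochVertex (k + 1) (4 * i + (r + 1)))
        (kochVertex (k + 1) (4 * i + r)) (kochVertex k i)
      push_cast
      rw [← add_assoc] at h2 ⊢
      linarith
  have hr' : (r : ℝ) ≤ 4 := by exact_mod_cast hr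
  have hpos : (0 : ℝ) < (1 / 3) ^ k := by positivity
  refine (h r).trans ?_
  rw [pow_succ]
  nlinarith

/-- A ball is convex, so it contains a side as soon as it contains both ends. -/
theorem dist_kochPolygon_le (k : ℕ) {t : ℝ} (ht : 0 ≤ t) {x : ℂ} {B : ℝ}
    (h0 : dist (kochVertex k ⌊3 * 4 ^ k * t⌋₊) x ≤ B)
    (h1 : dist (kochVertex k (⌊3 * 4 ^ k * t⌋₊ + 1)) x ≤ B) : dist (kochPolygon k t) x ≤ B := by
  have hs : (0 : ℝ) ≤ 3 * 4 ^ k * t := by positivity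
  have hf0 := Nat.floor_le hs
  have hf1 := Nat.lt_floor_add_one (3 * 4 ^ k * t)
  have hc := convex_closedBall x B
  have := hc.add_smul_sub_mem (x := kochVertex k ⌊3 * 4 ^ k * t⌋₊)
    (y := kochVertex k (⌊3 * 4 ^ k * t⌋₊ + 1)) h0 h1
    (t := 3 * 4 ^ k * t - ⌊3 * 4 ^ k * t⌋₊) ⟨by linarith, by linarith⟩
  rw [Complex.real_smul] at this
  exact this

theorem dist_kochPolygon_kochVertex_le (k : ℕ) {t : ℝ} (ht : 0 ≤ t) :
    dist (kochPolygon k t) (kochVertex k ⌊3 * 4 ^ k * t⌋₊) ≤ 2 * (1 / 3) ^ k := by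
  apply dist_kochPolygon_le k ht
  · rw [dist_self]; positivity
  · rw [dist_eq_norm]; exact norm_kochVertex_sub_le _ _

theorem dist_kochPolygon_succ_le (k : ℕ) {t : ℝ} (ht : 0 ≤ t) :
    dist (kochPolygon k t) (kochPolygon (k + 1) t) ≤ 10 * (1 / 3) ^ k := by
  have hs : (0 : ℝ) ≤ 3 * 4 ^ k * t := by positivity
  have hs' : (0 : ℝ) ≤ 3 * 4 ^ (k + 1) * t := by positivity
  have h4 : (3 * 4 ^ (k + 1) * t : ℝ) = 4 * (3 * 4 ^ k * t) := by ring
  have key : dist (kochPolygon (k + 1) t) (kochVertex k ⌊3 * 4 ^ k * t⌋₊) ≤ 8 * (1 / 3) ^ k := by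
    have hlo : 4 * ⌊3 * 4 ^ k * t⌋₊ ≤ ⌊3 * 4 ^ (k + 1) * t⌋₊ := by
      apply Nat.le_floor
      push_cast
      have := Nat.floor_le hs
      rw [h4]; linarith
    have hhi : ⌊3 * 4 ^ (k + 1) * t⌋₊ < 4 * ⌊3 * 4 ^ k * t⌋₊ + 4 := by
      rw [Nat.floor_lt hs', h4]
      push_cast
      have := Nat.lt_floor_add_one (3 * 4 ^ k * t)
      linarith
    -- The finer side containing the point runs from vertex `4 * i + r` to the next one with `r ≤
    -- 3`, where `i` is the coarse index, so both ends are covered by the bound for `r ≤ 4`.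
    obtain ⟨r, hr⟩ := Nat.exists_eq_add_of_le hlo
    apply dist_kochPolygon_le (k + 1) ht
    · rw [hr]; exact dist_kochVertex_succ_le _ _ _ (by omega)
    · rw [hr, add_assoc]; exact dist_kochVertex_succ_le _ _ _ (by omega)
  have h1 := dist_kochPolygon_kochVertex_le k ht
  have := dist_triangle_right (kochPolygon k t) (kochPolygon (k + 1) t)
    (kochVertex k ⌊3 * 4 ^ k * t⌋₊)
  linarith

theorem kochPolygon_node (k j : ℕ) : kochPolygon k (j / (3 * 4 ^ k)) = kochVertex k j := by
  have : (3 * 4 ^ k * (j / (3 * 4 ^ k)) : ℝ) = j := by field_simp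
  simp [kochPolygon, this]

theorem kochPolygon_add_node (k m j : ℕ) :
    kochPolygon (k + m) (j / (3 * 4 ^ k)) = kochVertex k j := by
  rw [← kochVertex_add_pow_mul k m j, ← kochPolygon_node]
  congr 1
  push_cast
  rw [pow_add]
  field_simp

theorem dist_kochPolygon_of_close (k : ℕ) {s t : ℝ} (hs : 0 ≤ s) (hst : s ≤ t)
    (h : 3 * 4 ^ k * (t - s) < 1) : dist (kochPolygon k s) (kochPolygon k t) ≤ 6 * (1 / 3) ^ k := by
  have hs' : (0 : ℝ) ≤ 3 * 4 ^ k * s := by positivity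
  have ht' : (0 : ℝ) ≤ 3 * 4 ^ k * t := mul_nonneg (by positivity) (hs.trans hst)
  have h1 := dist_kochPolygon_kochVertex_le k hs
  have h2 := dist_kochPolygon_kochVertex_le k (hs.trans hst)
  have hlo : ⌊3 * 4 ^ k * s⌋₊ ≤ ⌊3 * 4 ^ k * t⌋₊ := Nat.floor_mono (by gcongr)
  have hhi : ⌊3 * 4 ^ k * t⌋₊ < ⌊3 * 4 ^ k * s⌋₊ + 2 := by
    rw [Nat.floor_lt ht']
    push_cast
    have := Nat.lt_floor_add_one (3 * 4 ^ k * s)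
    linarith
  have h3 : dist (kochVertex k ⌊3 * 4 ^ k * t⌋₊) (kochVertex k ⌊3 * 4 ^ k * s⌋₊) ≤
      2 * (1 / 3) ^ k := by
    obtain h | h : ⌊3 * 4 ^ k * t⌋₊ = ⌊3 * 4 ^ k * s⌋₊ ∨
        ⌊3 * 4 ^ k * t⌋₊ = ⌊3 * 4 ^ k * s⌋₊ + 1 := by omega
    · rw [h, dist_self]; positivity
    · rw [h, dist_eq_norm]; exact norm_kochVertex_sub_le _ _
  have h4 := dist_triangle4_right (kochPolygon k s) (kochPolygon k t)
    (kochVertex k ⌊3 * 4 ^ k * s⌋₊) (kochVertex k ⌊3 * 4 ^ k * t⌋₊)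
  rw [dist_comm (kochVertex k ⌊3 * 4 ^ k * s⌋₊)] at h4
  linarith

/-- The second clause places all vertices of all polygons on the limit curve, because later
refinements fix them. It is the link to the gasket. -/
theorem exists_kochCurve : ∃ g : C(unitInterval, ℂ),
    TendstoUniformly (fun (k : ℕ) (t : unitInterval) => kochPolygon k (t : ℝ)) g atTop ∧
    ∀ (k j : ℕ) (t : unitInterval), (t : ℝ) = j / (3 * 4 ^ k) → g t = kochVertex k j := by
  have hd : ∀ (t : unitInterval) (k : ℕ),
      dist (kochPolygon k t) (kochPolygon (k + 1) t) ≤ 10 * (1 / 3) ^ k :=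
    fun t k => dist_kochPolygon_succ_le k t.2.1
  have hlim : ∀ t : unitInterval, ∃ z, Tendsto (fun k => kochPolygon k t) atTop (𝓝 z) :=
    fun t => cauchySeq_tendsto_of_complete
      (cauchySeq_of_le_geometric (1 / 3) 10 (by norm_num) (hd t))
  choose g hg using hlim
  have hdist : ∀ (t : unitInterval) (k : ℕ), dist (kochPolygon k t) (g t) ≤ 15 * (1 / 3) ^ k := by
    intro t k
    have := dist_le_of_le_geometric_of_tendsto (1 / 3) 10 (by norm_num) (hd t) (hg t) k
    have h2 : (10 * (1 / 3) ^ k / (1 - 1 / 3) : ℝ) = 15 * (1 / 3) ^ k := by ring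
    rwa [h2] at this
  have hsmall : ∀ ε > 0, ∃ N : ℕ, ∀ k ≥ N, (36 * (1 / 3) ^ k : ℝ) < ε := by
    intro ε hε
    have : Tendsto (fun k : ℕ => (36 * (1 / 3) ^ k : ℝ)) atTop (𝓝 (36 * 0)) :=
      (tendsto_pow_atTop_nhds_zero_of_lt_one (by norm_num) (by norm_num)).const_mul _
    rw [mul_zero] at this
    exact eventually_atTop.1 (this.eventually_lt_const hε)
  -- Here `36 = 15 + 6 + 15`: two passages to the limit and one comparison within the `k`-th
  -- polygon.
  have hclose : ∀ (k : ℕ) (s t : unitInterval), (s : ℝ) ≤ t → 3 * 4 ^ k * ((t : ℝ) - s) < 1 →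
      dist (g s) (g t) ≤ 36 * (1 / 3) ^ k := by
    intro k s t hst h
    have h1 := dist_kochPolygon_of_close k s.2.1 hst h
    have h2 := hdist s k
    have h3 := hdist t k
    have h4 := dist_triangle4 (g s) (kochPolygon k s) (kochPolygon k t) (g t)
    rw [dist_comm (g s) (kochPolygon k s)] at h4
    linarith
  have hcont : Continuous g := by
    rw [Metric.continuous_iff]
    intro s ε hε
    obtain ⟨N, hN⟩ := hsmall ε hε
    refine ⟨1 / (3 * 4 ^ N), by positivity, fun t ht => ?_⟩
    rw [Subtype.dist_eq, Real.dist_eq, lt_div_iff₀ (by positivity)] at ht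
    refine lt_of_le_of_lt ?_ (hN N le_rfl)
    rcases le_total (s : ℝ) t with h | h
    · rw [dist_comm]
      rw [abs_of_nonneg (by linarith)] at ht
      exact hclose N s t h (by linarith)
    · rw [abs_of_nonpos (by linarith)] at ht
      exact hclose N t s h (by linarith)
  refine ⟨⟨g, hcont⟩, ?_, ?_⟩
  · rw [Metric.tendstoUniformly_iff]
    intro ε hε
    obtain ⟨N, hN⟩ := hsmall ε hε
    filter_upwards [eventually_ge_atTop N] with k hk t
    have := hdist t k
    have h2 := hN k hk
    have h3 : (0 : ℝ) < (1 / 3) ^ k := by positivity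
    rw [dist_comm]
    simp only [ContinuousMap.coe_mk]
    linarith
  · intro k j t ht
    refine tendsto_nhds_unique (hg t) (tendsto_atTop_of_eventually_const (i₀ := k) ?_)
    intro i hi
    obtain ⟨m, rfl⟩ := Nat.exists_eq_add_of_le hi
    rw [ht, kochPolygon_add_node]

/-! ### Model polygons

The model plane `ℝ × ℝ` has the coordinates `x / √3` and `y`, which makes all slopes rational. -/

/-- The rhombus with center `c` and radius `r` in the model plane. -/
def modelRhombus (c : ℝ × ℝ) (r : ℝ) : Set (ℝ × ℝ) :=
  {z | |z.1 - c.1| + |z.2 - c.2| ≤ r}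

/-- The model of the initial region. -/
def modelStart : Set (ℝ × ℝ) := {z | 3 * |z.1| + |z.2| < 1}

/-- The model of the open dart with tip `(1, 0)`, reflex vertex `(1 / 3, 0)` and other vertices
`(0, ±1)`. -/
def modelDart : Set (ℝ × ℝ) := {z | 1 < 3 * z.1 + |z.2| ∧ z.1 + |z.2| < 1}

/-- The model of the open right triangle with vertices `(1, 0)`, `(0, 1)` and `(1 / 3, 2)`. -/
def modelTriangle : Set (ℝ × ℝ) := {z | 1 < z.1 + z.2 ∧ 3 * z.1 + z.2 < 3 ∧ z.2 - 3 * z.1 < 1}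

/-! ### Topology of the model regions -/

theorem isOpen_modelStart : IsOpen modelStart :=
  isOpen_lt (by fun_prop) (by fun_prop)

theorem isOpen_modelDart : IsOpen modelDart :=
  (isOpen_lt (by fun_prop) (by fun_prop)).and (isOpen_lt (by fun_prop) (by fun_prop))

theorem isOpen_modelTriangle : IsOpen modelTriangle :=
  (isOpen_lt (by fun_prop) (by fun_prop)).and
    ((isOpen_lt (by fun_prop) (by fun_prop)).and (isOpen_lt (by fun_prop) (by fun_prop)))

/-- Points of `P` pulled slightly towards `c` land in `U`; letting `s` tend to `0` recovers them.
Only a star shape is needed, since the dart is not convex. -/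
theorem closure_eq_of_forall_segment {E : Type*} [AddCommGroup E] [Module ℝ E] [TopologicalSpace E]
    [ContinuousAdd E] [ContinuousSMul ℝ E] {U P : Set E} (c : E) (hUP : U ⊆ P) (hP : IsClosed P)
    (h : ∀ z ∈ P, ∀ s : ℝ, 0 < s → s ≤ 1 → (1 - s) • z + s • c ∈ U) : closure U = P := by
  refine (closure_minimal hUP hP).antisymm fun z hz => ?_
  have ht : Tendsto (fun s : ℝ => (1 - s) • z + s • c) (𝓝[>] 0) (𝓝 z) := by
    have : Continuous fun s : ℝ => (1 - s) • z + s • c := by fun_prop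
    have := this.tendsto 0
    simp only [sub_zero, one_smul, zero_smul, add_zero] at this
    exact this.mono_left nhdsWithin_le_nhds
  refine mem_closure_of_tendsto ht ?_
  filter_upwards [Ioc_mem_nhdsGT (show (0 : ℝ) < 1 by norm_num)] with s hs
  exact h z hz s hs.1 hs.2

theorem isPreconnected_of_forall_segment {E : Type*} [AddCommGroup E] [Module ℝ E]
    [TopologicalSpace E] [ContinuousAdd E] [ContinuousSMul ℝ E] {U : Set E} (c : E)
    (hc : c ∈ U)
    (h : ∀ z ∈ U, ∀ s : ℝ, 0 < s → s ≤ 1 → (1 - s) • z + s • c ∈ U) : IsPreconnected U := by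
  have hstar : StarConvex ℝ c U := by
    intro z hz s t hs ht hst
    rcases hs.eq_or_lt with rfl | hs
    · obtain rfl : t = 1 := by linarith
      simpa using hz
    · have := h z hz s hs (by linarith)
      rwa [show 1 - s = t by linarith, add_comm] at this
  exact (hstar.isPathConnected hc).isConnected.isPreconnected

theorem modelStart_segment (z : ℝ × ℝ) (hz : 3 * |z.1| + |z.2| ≤ 1) (s : ℝ) (hs : 0 < s)
    (hs1 : s ≤ 1) : (1 - s) • z + s • ((0, 0) : ℝ × ℝ) ∈ modelStart := by
  have h1 : (0 : ℝ) ≤ 1 - s := by linarith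
  simp only [modelStart, mem_ofPred_eq, Prod.fst_add, Prod.snd_add, Prod.smul_fst, Prod.smul_snd,
    smul_eq_mul, mul_zero, add_zero, abs_mul, abs_of_nonneg h1]
  nlinarith [mul_le_mul_of_nonneg_left hz h1]

theorem modelDart_segment (z : ℝ × ℝ) (hz : 1 ≤ 3 * z.1 + |z.2| ∧ z.1 + |z.2| ≤ 1) (s : ℝ)
    (hs : 0 < s) (hs1 : s ≤ 1) : (1 - s) • z + s • ((2 / 3, 0) : ℝ × ℝ) ∈ modelDart := by
  have h1 : (0 : ℝ) ≤ 1 - s := by linarith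
  simp only [modelDart, mem_ofPred_eq, Prod.fst_add, Prod.snd_add, Prod.smul_fst, Prod.smul_snd,
    smul_eq_mul, mul_zero, add_zero, abs_mul, abs_of_nonneg h1]
  have h2 := mul_le_mul_of_nonneg_left hz.1 h1
  have h3 := mul_le_mul_of_nonneg_left hz.2 h1
  constructor <;> linarith

theorem modelTriangle_segment (z : ℝ × ℝ)
    (hz : 1 ≤ z.1 + z.2 ∧ 3 * z.1 + z.2 ≤ 3 ∧ z.2 - 3 * z.1 ≤ 1) (s : ℝ)
    (hs : 0 < s) (hs1 : s ≤ 1) : (1 - s) • z + s • ((1 / 3, 1) : ℝ × ℝ) ∈ modelTriangle := by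
  have h1 : (0 : ℝ) ≤ 1 - s := by linarith
  simp only [modelTriangle, mem_ofPred_eq, Prod.fst_add, Prod.snd_add, Prod.smul_fst,
    Prod.smul_snd, smul_eq_mul]
  have h2 := mul_le_mul_of_nonneg_left hz.1 h1
  have h3 := mul_le_mul_of_nonneg_left hz.2.1 h1
  have h4 := mul_le_mul_of_nonneg_left hz.2.2 h1
  refine ⟨?_, ?_, ?_⟩ <;> linarith

theorem closure_modelStart : closure modelStart = {z | 3 * |z.1| + |z.2| ≤ 1} :=
  closure_eq_of_forall_segment (0, 0) (fun z (hz : 3 * |z.1| + |z.2| < 1) => hz.le)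
    (isClosed_le (by fun_prop) (by fun_prop)) modelStart_segment

theorem closure_modelDart :
    closure modelDart = {z | 1 ≤ 3 * z.1 + |z.2| ∧ z.1 + |z.2| ≤ 1} :=
  closure_eq_of_forall_segment (2 / 3, 0) (fun _ hz => ⟨hz.1.le, hz.2.le⟩)
    ((isClosed_le (by fun_prop) (by fun_prop)).and (isClosed_le (by fun_prop) (by fun_prop)))
    modelDart_segment

theorem closure_modelTriangle : closure modelTriangle =
    {z | 1 ≤ z.1 + z.2 ∧ 3 * z.1 + z.2 ≤ 3 ∧ z.2 - 3 * z.1 ≤ 1} :=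
  closure_eq_of_forall_segment (1 / 3, 1) (fun _ hz => ⟨hz.1.le, hz.2.1.le, hz.2.2.le⟩)
    ((isClosed_le (by fun_prop) (by fun_prop)).and
      ((isClosed_le (by fun_prop) (by fun_prop)).and (isClosed_le (by fun_prop) (by fun_prop))))
    modelTriangle_segment

theorem isPreconnected_modelDart : IsPreconnected modelDart :=
  isPreconnected_of_forall_segment (2 / 3, 0) (by simp only [modelDart, mem_ofPred_eq]; norm_num)
    fun z hz => modelDart_segment z ⟨hz.1.le, hz.2.le⟩

theorem isPreconnected_modelTriangle : IsPreconnected modelTriangle :=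
  isPreconnected_of_forall_segment (1 / 3, 1) (by simp only [modelTriangle, mem_ofPred_eq]; norm_num)
    fun z hz => modelTriangle_segment z ⟨hz.1.le, hz.2.1.le, hz.2.2.le⟩

theorem nonempty_modelDart : modelDart.Nonempty := ⟨(2 / 3, 0), by constructor <;> norm_num⟩

theorem nonempty_modelTriangle : modelTriangle.Nonempty :=
  ⟨(1 / 3, 1), by refine ⟨?_, ?_, ?_⟩ <;> norm_num⟩

/-- The similarity of the model plane (a reflection in a diagonal line, composed with sign changes,
a contraction by `1 / √3` and a translation) that places the models of the next iteration. -/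
def childMap (x y : ℝ) (e f : ℤˣ) : ℝ × ℝ ≃ₜ ℝ × ℝ where
  toFun z := (x + ((e : ℤ) : ℝ) * z.2 / 3, y + ((f : ℤ) : ℝ) * z.1)
  invFun z := (((f : ℤ) : ℝ) * (z.2 - y), ((e : ℤ) : ℝ) * (3 * (z.1 - x)))
  left_inv z := by
    rcases Int.units_eq_one_or e with rfl | rfl <;> rcases Int.units_eq_one_or f with rfl | rfl <;>
      ext <;> simp <;> ring
  right_inv z := by
    rcases Int.units_eq_one_or e with rfl | rfl <;> rcases Int.units_eq_one_or f with rfl | rfl <;>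
      ext <;> simp
  continuous_toFun := by fun_prop
  continuous_invFun := by fun_prop

theorem childMap_apply (x y : ℝ) (e f : ℤˣ) (z : ℝ × ℝ) :
    childMap x y e f z = (x + ((e : ℤ) : ℝ) * z.2 / 3, y + ((f : ℤ) : ℝ) * z.1) := rfl

theorem mem_image_childMap {x y : ℝ} {e f : ℤˣ} {S : Set (ℝ × ℝ)} {z : ℝ × ℝ} :
    z ∈ childMap x y e f '' S ↔
      (((f : ℤ) : ℝ) * (z.2 - y), ((e : ℤ) : ℝ) * (3 * (z.1 - x))) ∈ S := by
  rw [show childMap x y e f '' S = (childMap x y e f).symm ⁻¹' S from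
    (childMap x y e f).toEquiv.image_eq_preimage_symm S]
  rfl

/-- `modelRhombus c r` is the unique largest rhombus in `P`. -/
def IsUniqueLargest (P : Set (ℝ × ℝ)) (c : ℝ × ℝ) (r : ℝ) : Prop :=
  0 < r ∧ modelRhombus c r ⊆ P ∧
    ∀ c' r', 0 < r' → modelRhombus c' r' ⊆ P → r' ≤ r ∧ (r' = r → c' = c)

/-! ### Largest rhombi in the models -/

/-- The conditions at these four points already force the maximal radius and, in case of equality,
the center, even in the nonconvex dart. -/
theorem modelRhombus_vertices {c : ℝ × ℝ} {r : ℝ} (hr : 0 < r) {P : Set (ℝ × ℝ)}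
    (h : modelRhombus c r ⊆ P) :
    (c.1 + r, c.2) ∈ P ∧ (c.1 - r, c.2) ∈ P ∧ (c.1, c.2 + r) ∈ P ∧ (c.1, c.2 - r) ∈ P := by
  refine ⟨h ?_, h ?_, h ?_, h ?_⟩ <;> simp [modelRhombus, abs_of_pos hr]

theorem isUniqueLargest_start : IsUniqueLargest (closure modelStart) (0, 0) (1 / 3) := by
  rw [closure_modelStart]
  refine ⟨by norm_num, ?_, ?_⟩
  · rintro ⟨x, y⟩ hz
    simp only [modelRhombus, mem_ofPred_eq, sub_zero] at hz ⊢
    linarith [abs_nonneg x, abs_nonneg y]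
  · rintro ⟨x, y⟩ r hr h
    obtain ⟨h1, h2, h3, h4⟩ := modelRhombus_vertices hr h
    simp only [mem_ofPred_eq] at h1 h2 h3 h4
    have a1 := le_abs_self (x + r)
    have a2 := neg_le_abs (x - r)
    have a3 := abs_nonneg y
    refine ⟨by linarith, ?_⟩
    rintro rfl
    have hy : |y| = 0 := by linarith
    have hx1 : x = 0 := by linarith
    rw [abs_eq_zero] at hy
    rw [hx1, hy]

theorem isUniqueLargest_dart : IsUniqueLargest (closure modelDart) (2 / 3, 0) (1 / 3) := by
  rw [closure_modelDart]
  refine ⟨by norm_num, ?_, ?_⟩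
  · rintro ⟨x, y⟩ hz
    simp only [modelRhombus, mem_ofPred_eq, sub_zero] at hz ⊢
    have h1 := le_abs_self (x - 2 / 3)
    have h2 := neg_le_abs (x - 2 / 3)
    constructor <;> linarith [abs_nonneg y]
  · rintro ⟨x, y⟩ r hr h
    obtain ⟨h1, h2, h3, h4⟩ := modelRhombus_vertices hr h
    simp only [mem_ofPred_eq] at h1 h2 h3 h4
    have a3 := abs_nonneg y
    refine ⟨by linarith, ?_⟩
    rintro rfl
    have hy : |y| = 0 := by linarith
    have hx1 : x = 2 / 3 := by linarith
    rw [abs_eq_zero] at hy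
    rw [hx1, hy]

theorem isUniqueLargest_triangle : IsUniqueLargest (closure modelTriangle) (1 / 3, 1) (1 / 3) := by
  rw [closure_modelTriangle]
  refine ⟨by norm_num, ?_, ?_⟩
  · rintro ⟨x, y⟩ hz
    simp only [modelRhombus, mem_ofPred_eq] at hz ⊢
    have h1 := le_abs_self (x - 1 / 3)
    have h2 := neg_le_abs (x - 1 / 3)
    have h3 := le_abs_self (y - 1)
    have h4 := neg_le_abs (y - 1)
    refine ⟨?_, ?_, ?_⟩ <;> linarith
  · rintro ⟨x, y⟩ r hr h
    obtain ⟨h1, h2, h3, h4⟩ := modelRhombus_vertices hr h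
    simp only [mem_ofPred_eq] at h1 h2 h3 h4
    refine ⟨by linarith, ?_⟩
    rintro rfl
    have hy : y = 1 := by linarith
    have hx1 : x = 1 / 3 := by linarith
    rw [hx1, hy]

/-! ### Dissection of the models by their largest rhombi -/

theorem modelStart_sdiff : modelStart \ modelRhombus (0, 0) (1 / 3) =
    childMap 0 0 (-1) (-1) '' modelDart ∪ childMap 0 0 1 1 '' modelDart := by
  ext ⟨x, y⟩
  simp only [mem_union, mem_image_childMap, Set.mem_sdiff]
  simp only [modelStart, modelRhombus, modelDart, mem_ofPred_eq, not_le, sub_zero]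
  push_cast
  simp only [neg_mul, one_mul, abs_neg, abs_mul, abs_of_pos (show (0 : ℝ) < 3 by norm_num)]
  constructor
  · rintro ⟨h1, h2⟩
    rcases abs_cases y with ⟨hy, -⟩ | ⟨hy, -⟩
    · right; rw [hy] at h1 h2; constructor <;> linarith
    · left; rw [hy] at h1 h2; constructor <;> linarith
  · rintro (⟨h1, h2⟩ | ⟨h1, h2⟩)
    · have hy : |y| = -y := abs_of_neg (by linarith)
      rw [hy]; constructor <;> linarith
    · have hy : |y| = y := abs_of_pos (by linarith)
      rw [hy]; constructor <;> linarith

theorem modelDart_sdiff : modelDart \ modelRhombus (2 / 3, 0) (1 / 3) =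
    childMap 0 0 1 (-1) '' modelTriangle ∪ childMap 0 0 1 1 '' modelTriangle := by
  ext ⟨x, y⟩
  simp only [mem_union, mem_image_childMap, Set.mem_sdiff]
  simp only [modelTriangle, modelRhombus, modelDart, mem_ofPred_eq, not_le, sub_zero]
  push_cast
  simp only [neg_mul, one_mul]
  constructor
  · rintro ⟨⟨h1, h2⟩, h3⟩
    rcases abs_cases y with ⟨hy, -⟩ | ⟨hy, -⟩ <;>
      rcases abs_cases (x - 2 / 3) with ⟨hx, -⟩ | ⟨hx, -⟩ <;> rw [hy] at h1 h2 h3 <;>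
        rw [hx] at h3
    -- To the right of its center the rhombus fills the dart, so this case is void.
    · linarith
    · right; refine ⟨?_, ?_, ?_⟩ <;> linarith
    · linarith
    · left; refine ⟨?_, ?_, ?_⟩ <;> linarith
  · have hx := neg_le_abs (x - 2 / 3)
    rintro (⟨h1, h2, h3⟩ | ⟨h1, h2, h3⟩)
    · have hy : |y| = -y := abs_of_neg (by linarith)
      rw [hy]; refine ⟨⟨?_, ?_⟩, ?_⟩ <;> linarith
    · have hy : |y| = y := abs_of_pos (by linarith)
      rw [hy]; refine ⟨⟨?_, ?_⟩, ?_⟩ <;> linarith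

/-- The sign `e` is free because the dart is symmetric about its axis; it is chosen later to match
the direction in which the Koch polygon passes through. -/
theorem modelTriangle_sdiff (e : ℤˣ) : modelTriangle \ modelRhombus (1 / 3, 1) (1 / 3) =
    childMap 1 1 (-1) (-1) '' modelTriangle ∪ childMap (1 / 3) 1 e 1 '' modelDart := by
  have he : |((e : ℤ) : ℝ)| = 1 := by
    rcases Int.units_eq_one_or e with rfl | rfl <;> simp
  ext ⟨x, y⟩
  simp only [mem_union, mem_image_childMap, Set.mem_sdiff]
  simp only [modelTriangle, modelRhombus, modelDart, mem_ofPred_eq, not_le]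
  push_cast
  simp only [neg_mul, one_mul, abs_mul, he, abs_of_pos (show (0 : ℝ) < 3 by norm_num)]
  have hx1 := le_abs_self (x - 1 / 3)
  have hx2 := neg_le_abs (x - 1 / 3)
  have hy1 := le_abs_self (y - 1)
  have hy2 := neg_le_abs (y - 1)
  constructor
  · rintro ⟨⟨h1, h2, h3⟩, h4⟩
    rcases abs_cases (y - 1) with ⟨hy, -⟩ | ⟨hy, -⟩ <;>
      rcases abs_cases (x - 1 / 3) with ⟨hx, -⟩ | ⟨hx, -⟩ <;> rw [hx, hy] at h4
    · right; rw [hx]; constructor <;> linarith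
    · right; rw [hx]; constructor <;> linarith
    · left; refine ⟨?_, ?_, ?_⟩ <;> linarith
    -- Below and to the left of the center, a side of the rhombus lies on a side of the triangle, so
    -- nothing remains there.
    · linarith
  · rintro (⟨h1, h2, h3⟩ | ⟨h1, h2⟩)
    · refine ⟨⟨?_, ?_, ?_⟩, ?_⟩ <;> linarith
    · refine ⟨⟨?_, ?_, ?_⟩, ?_⟩ <;> linarith

theorem disjoint_children_start :
    Disjoint (childMap 0 0 (-1) (-1) '' modelDart) (childMap 0 0 1 1 '' modelDart) := by
  rw [Set.disjoint_left]
  rintro ⟨x, y⟩ h h'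
  rw [mem_image_childMap] at h h'
  simp only [modelDart, mem_ofPred_eq, sub_zero] at h h'
  push_cast at h h'
  simp only [neg_mul, one_mul, abs_neg] at h h'
  linarith [h.1, h.2, h'.1, h'.2]

theorem disjoint_children_dart :
    Disjoint (childMap 0 0 1 (-1) '' modelTriangle) (childMap 0 0 1 1 '' modelTriangle) := by
  rw [Set.disjoint_left]
  rintro ⟨x, y⟩ h h'
  rw [mem_image_childMap] at h h'
  simp only [modelTriangle, mem_ofPred_eq, sub_zero] at h h'
  push_cast at h h'
  simp only [neg_mul, one_mul] at h h'
  linarith [h.1, h.2.1, h.2.2, h'.1, h'.2.1, h'.2.2]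

theorem disjoint_children_triangle (e : ℤˣ) :
    Disjoint (childMap 1 1 (-1) (-1) '' modelTriangle) (childMap (1 / 3) 1 e 1 '' modelDart) := by
  have he : |((e : ℤ) : ℝ)| = 1 := by
    rcases Int.units_eq_one_or e with rfl | rfl <;> simp
  rw [Set.disjoint_left]
  rintro ⟨x, y⟩ h h'
  rw [mem_image_childMap] at h h'
  simp only [modelTriangle, modelDart, mem_ofPred_eq] at h h'
  push_cast at h h'
  simp only [neg_mul, one_mul, abs_mul, he, abs_of_pos (show (0 : ℝ) < 3 by norm_num)] at h h'
  have hx1 := le_abs_self (x - 1 / 3)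
  have hx2 := neg_le_abs (x - 1 / 3)
  linarith [h.1, h.2.1, h.2.2, h'.1, h'.2]

/-! ### Frames -/

/-- `Φ` is an affine map from the model plane that turns model rhombi into rhombi of the
orientation of iteration `n + 1`. -/
def IsFrame (n : ℕ) (c : ℂ) (p q : ℝ) (Φ : ℝ × ℝ ≃ₜ ℂ) : Prop :=
  ∀ z, Φ z = if Odd n then ⟨c.re + √3 * p * z.1, c.im + q * z.2⟩
    else ⟨c.re + q * z.2, c.im + √3 * p * z.1⟩

/-- The aspect ratio `1 / √3` cancels the stretching by `√3`, so rhombi become balls of the sum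
norm. Swapping the axes with the parity of `n` absorbs the change of orientation. -/
theorem IsFrame.rhombus_eq {n : ℕ} {c : ℂ} {p q : ℝ} {Φ : ℝ × ℝ ≃ₜ ℂ} (h : IsFrame n c p q Φ)
    (hp : 0 < |p|) (hpq : |q| = |p|) (x : ℝ × ℝ) (r : ℝ) :
    rhombus (1 / √3) (n + 1) (Φ x) (|p| * r) = Φ '' modelRhombus x r := by
  have key : ∀ u v : ℝ, 1 / √3 * |√3 * p * u| + |q * v| = |p| * (|u| + |v|) := by
    intro u v
    rw [abs_mul, abs_mul, abs_mul, hpq, abs_of_pos (show 0 < √3 by positivity)]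
    field_simp
  ext w
  obtain ⟨z, rfl⟩ := Φ.surjective w
  rw [Φ.injective.mem_set_image]
  by_cases hn : Odd n
  · have hn1 : ¬ Odd (n + 1) := by simpa [Nat.odd_add_one] using hn
    simp only [rhombus, hn1, if_false, horizontalRhombus, modelRhombus, mem_ofPred_eq, h _, hn,
      if_true]
    rw [add_sub_add_left_eq_sub, add_sub_add_left_eq_sub, ← mul_sub, ← mul_sub, key,
      mul_le_mul_iff_right₀ hp]
  · have hn1 : Odd (n + 1) := by simpa [Nat.odd_add_one] using hn
    simp only [rhombus, hn1, if_false, verticalRhombus, modelRhombus, mem_ofPred_eq, h _, hn,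
      if_true]
    rw [add_sub_add_left_eq_sub, add_sub_add_left_eq_sub, ← mul_sub, ← mul_sub,
      add_comm |q * (z.2 - x.2)|, key, mul_le_mul_iff_right₀ hp]

/-- Maximality fixes the radius, and uniqueness of the center then leaves no choice of rhombus. -/
theorem IsFrame.isLargestRhombus_iff {n : ℕ} {c : ℂ} {p q : ℝ} {Φ : ℝ × ℝ ≃ₜ ℂ}
    (h : IsFrame n c p q Φ) (hp : 0 < |p|) (hpq : |q| = |p|) {P : Set (ℝ × ℝ)} {x : ℝ × ℝ} {r : ℝ}
    (hP : IsUniqueLargest P x r) (R : Set ℂ) :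
    IsLargestRhombus (1 / √3) (n + 1) (Φ '' P) R ↔ R = Φ '' modelRhombus x r := by
  obtain ⟨hr, hsub, hmax⟩ := hP
  have hrhombus : ∀ c' r', rhombus (1 / √3) (n + 1) c' r' =
      Φ '' modelRhombus (Φ.symm c') (r' / |p|) := by
    intro c' r'
    rw [← h.rhombus_eq hp hpq, Φ.apply_symm_apply, mul_div_cancel₀ _ hp.ne']
  have hself : rhombus (1 / √3) (n + 1) (Φ x) (|p| * r) = Φ '' modelRhombus x r :=
    h.rhombus_eq hp hpq x r
  constructor
  · rintro ⟨c', r', hr', rfl, hsub', hmax'⟩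
    rw [hrhombus, image_subset_image_iff Φ.injective] at hsub'
    obtain ⟨h1, h2⟩ := hmax _ _ (by positivity) hsub'
    have h3 := hmax' (Φ x) (|p| * r) (by positivity)
      (by rw [hself]; exact image_mono hsub)
    have h4 : r' / |p| = r := by
      refine le_antisymm h1 ?_
      rw [le_div_iff₀ hp]
      linarith
    rw [hrhombus, h2 h4, h4]
  · rintro rfl
    refine ⟨Φ x, |p| * r, by positivity, hself.symm, image_mono hsub, ?_⟩
    intro c' r' hr' hsub'
    rw [hrhombus, image_subset_image_iff Φ.injective] at hsub'
    have := (hmax _ _ (by positivity) hsub').1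
    rw [div_le_iff₀ hp] at this
    linarith

/-! ### Components of the remaining space -/

theorem connectedComponentIn_union_left {X : Type*} [TopologicalSpace X] {A B : Set X}
    (hA : IsOpen A) (hB : IsOpen B) (hAB : Disjoint A B) (hc : IsPreconnected A) {z : X}
    (hz : z ∈ A) : connectedComponentIn (A ∪ B) z = A := by
  apply Subset.antisymm
  · exact isPreconnected_connectedComponentIn.subset_left_of_subset_union hA hB hAB
      (connectedComponentIn_subset _ _) ⟨z, mem_connectedComponentIn (Or.inl hz), hz⟩
  · exact hc.subset_connectedComponentIn hz subset_union_left

theorem IsFrame.children_eq {n : ℕ} {c : ℂ} {p q : ℝ} {Φ : ℝ × ℝ ≃ₜ ℂ}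
    (h : IsFrame n c p q Φ) (hp : 0 < |p|) (hpq : |q| = |p|) {S A B : Set (ℝ × ℝ)}
    {x : ℝ × ℝ} {r : ℝ} (hS : IsUniqueLargest (closure S) x r) (hd : S \ modelRhombus x r = A ∪ B)
    (hAo : IsOpen A) (hBo : IsOpen B) (hA : IsPreconnected A) (hB : IsPreconnected B)
    (hAn : A.Nonempty) (hBn : B.Nonempty) (hAB : Disjoint A B) (V : Set ℂ) :
    (∃ R, IsLargestRhombus (1 / √3) (n + 1) (closure (Φ '' S)) R ∧
      ∃ z ∈ Φ '' S \ R, V = connectedComponentIn (Φ '' S \ R) z) ↔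
    V = Φ '' A ∨ V = Φ '' B := by
  simp only [← Φ.image_closure, h.isLargestRhombus_iff hp hpq hS, exists_eq_left,
    ← image_sdiff Φ.injective, hd, exists_mem_image]
  have hcA : ∀ z ∈ A, connectedComponentIn (Φ '' (A ∪ B)) (Φ z) = Φ '' A := by
    intro z hz
    rw [← Φ.image_connectedComponentIn (Or.inl hz),
      connectedComponentIn_union_left hAo hBo hAB hA hz]
  have hcB : ∀ z ∈ B, connectedComponentIn (Φ '' (A ∪ B)) (Φ z) = Φ '' B := by
    intro z hz
    rw [← Φ.image_connectedComponentIn (Or.inr hz), union_comm,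
      connectedComponentIn_union_left hBo hAo hAB.symm hB hz]
  constructor
  · rintro ⟨z, hz | hz, rfl⟩
    · exact Or.inl (hcA z hz)
    · exact Or.inr (hcB z hz)
  · rintro (rfl | rfl)
    · obtain ⟨z, hz⟩ := hAn
      exact ⟨z, Or.inl hz, (hcA z hz).symm⟩
    · obtain ⟨z, hz⟩ := hBn
      exact ⟨z, Or.inr hz, (hcB z hz).symm⟩

/-! ### Cells -/

/-- The model of the point that splits a segment in the passage to the next level. -/
def modelSplit (ε : ℤˣ) (P Q : ℝ × ℝ) : ℝ × ℝ :=
  (P.1 + (Q.1 - P.1) / 2 - ((ε : ℤ) : ℝ) * (Q.2 - P.2) / 6,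
    P.2 + (Q.2 - P.2) / 2 + ((ε : ℤ) : ℝ) * (Q.1 - P.1) / 2)

theorem units_mul_self (ε : ℤˣ) : ((ε : ℤ) : ℝ) * ((ε : ℤ) : ℝ) = 1 := by
  rcases Int.units_eq_one_or ε with rfl | rfl <;> simp

/-- A frame swaps the axes exactly for even `n`. This reversal compensates the alternating side of
`splitPoint`, so the side in the model depends on `ε` alone: left for `1`, right for `-1`. -/
theorem IsFrame.splitPoint_eq {n : ℕ} {c : ℂ} {p : ℝ} {ε : ℤˣ} {Φ : ℝ × ℝ ≃ₜ ℂ}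
    (h : IsFrame n c p ((ε : ℤ) * p) Φ) (P Q : ℝ × ℝ) :
    Φ P + splitPoint n * (Φ Q - Φ P) = Φ (modelSplit ε P Q) := by
  have h3 := sqrt_three_mul_self
  have he := units_mul_self ε
  rw [h, h, h]
  unfold splitPoint modelSplit
  generalize ((ε : ℤ) : ℝ) = e at *
  split_ifs <;> apply Complex.ext <;> simp <;> grind

theorem IsFrame.childMap_trans {n : ℕ} {c : ℂ} {p q : ℝ} {Φ : ℝ × ℝ ≃ₜ ℂ}
    (h : IsFrame n c p q Φ) (x y : ℝ) (e f : ℤˣ) :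
    IsFrame (n + 1) (Φ (x, y)) (q * (f : ℤ) / √3) (p * (e : ℤ) / √3)
      ((childMap x y e f).trans Φ) := by
  have h3 := sqrt_three_mul_self
  have h0 : √3 ≠ 0 := by positivity
  intro z
  rw [Homeomorph.trans_apply, h, h, childMap_apply]
  by_cases hn : Odd n <;> simp only [Nat.odd_add_one, hn, not_true, not_false_iff, if_true,
    if_false] <;> apply Complex.ext <;> simp only <;> field_simp <;> grind

/-- `U` is the image of the model `S` in a frame of level `n` in which the vertices
`3 * j, …, 3 * j + 3` of the binary refinement of the Koch polygon have the models `P i`. -/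
def IsCell (n j : ℕ) (ε : ℤˣ) (S : Set (ℝ × ℝ)) (P : Fin 4 → ℝ × ℝ) (U : Set ℂ) : Prop :=
  ∃ (c : ℂ) (p : ℝ) (Φ : ℝ × ℝ ≃ₜ ℂ), IsFrame n c p ((ε : ℤ) * p) Φ ∧
    |p| = √3 * (1 / √3) ^ n ∧ U = Φ '' S ∧ ∀ i : Fin 4, kochHalf n (3 * j + i) = Φ (P i)

theorem abs_units_mul (ε : ℤˣ) (p : ℝ) : |((ε : ℤ) : ℝ) * p| = |p| := by
  rcases Int.units_eq_one_or ε with rfl | rfl <;> simp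

/-- The two scale factors trade places in the child frame, so their new sign ratio is `e * f * ε`.
-/
theorem IsFrame.isCell_child {n j : ℕ} {c : ℂ} {p : ℝ} {ε : ℤˣ} {Φ : ℝ × ℝ ≃ₜ ℂ}
    (h : IsFrame n c p ((ε : ℤ) * p) Φ) (hp : |p| = √3 * (1 / √3) ^ n) (x y : ℝ) (e f : ℤˣ)
    {δ : ℤˣ} (hδ : e * f * ε = δ) (S : Set (ℝ × ℝ)) {P Q : Fin 4 → ℝ × ℝ}
    (hQ : ∀ i : Fin 4, kochHalf (n + 1) (3 * j + i) = Φ (Q i))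
    (hPQ : ∀ i, childMap x y e f (P i) = Q i) :
    IsCell (n + 1) j δ S P (Φ '' (childMap x y e f '' S)) := by
  subst hδ
  refine ⟨Φ (x, y), ((ε : ℤ) * p) * (f : ℤ) / √3, (childMap x y e f).trans Φ, ?_, ?_, ?_, ?_⟩
  · convert h.childMap_trans x y e f using 1
    have h1 := units_mul_self f
    have h2 := units_mul_self ε
    push_cast
    linear_combination ((e : ℤ) : ℝ) * p / √3 * ((((f : ℤ) : ℝ) * ((f : ℤ) : ℝ)) * h2 + h1)
  · rw [abs_div, mul_comm, abs_units_mul, abs_units_mul, hp, abs_of_pos (by positivity), pow_succ]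
    ring
  · rw [image_image]; rfl
  · intro i
    rw [hQ, ← hPQ]; rfl

theorem IsFrame.kochHalf_left {n j : ℕ} {c : ℂ} {p : ℝ} {ε : ℤˣ} {Φ : ℝ × ℝ ≃ₜ ℂ}
    (h : IsFrame n c p ((ε : ℤ) * p) Φ) {P : Fin 4 → ℝ × ℝ}
    (hP : ∀ i : Fin 4, kochHalf n (3 * j + i) = Φ (P i)) (i : Fin 4) :
    kochHalf (n + 1) (3 * (2 * j) + i) =
      Φ (![P 0, modelSplit ε (P 0) (P 1), P 1, modelSplit ε (P 1) (P 2)] i) := by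
  have h0 : kochHalf n (3 * j) = Φ (P 0) := hP 0
  have h1 : kochHalf n (3 * j + 1) = Φ (P 1) := hP 1
  have h2 : kochHalf n (3 * j + 2) = Φ (P 2) := hP 2
  fin_cases i
  · change kochHalf (n + 1) (3 * (2 * j)) = Φ (P 0)
    rw [← h0, ← kochHalf_two_mul n]; congr 1; ring
  · change kochHalf (n + 1) (3 * (2 * j) + 1) = Φ (modelSplit ε (P 0) (P 1))
    rw [← h.splitPoint_eq, ← h0, ← h1, ← kochHalf_two_mul_add_one]; congr 1; ring
  · change kochHalf (n + 1) (3 * (2 * j) + 2) = Φ (P 1)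
    rw [← h1, ← kochHalf_two_mul n]; congr 1; ring
  · change kochHalf (n + 1) (3 * (2 * j) + 3) = Φ (modelSplit ε (P 1) (P 2))
    rw [← h.splitPoint_eq, ← h1, ← h2, ← kochHalf_two_mul_add_one]; congr 1; ring

theorem IsFrame.kochHalf_right {n j : ℕ} {c : ℂ} {p : ℝ} {ε : ℤˣ} {Φ : ℝ × ℝ ≃ₜ ℂ}
    (h : IsFrame n c p ((ε : ℤ) * p) Φ) {P : Fin 4 → ℝ × ℝ}
    (hP : ∀ i : Fin 4, kochHalf n (3 * j + i) = Φ (P i)) (i : Fin 4) :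
    kochHalf (n + 1) (3 * (2 * j + 1) + i) =
      Φ (![modelSplit ε (P 1) (P 2), P 2, modelSplit ε (P 2) (P 3), P 3] i) := by
  have h1 : kochHalf n (3 * j + 1) = Φ (P 1) := hP 1
  have h2 : kochHalf n (3 * j + 2) = Φ (P 2) := hP 2
  have h3 : kochHalf n (3 * j + 3) = Φ (P 3) := hP 3
  fin_cases i
  · change kochHalf (n + 1) (3 * (2 * j + 1)) = Φ (modelSplit ε (P 1) (P 2))
    rw [← h.splitPoint_eq, ← h1, ← h2, ← kochHalf_two_mul_add_one]; congr 1; ring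
  · change kochHalf (n + 1) (3 * (2 * j + 1) + 1) = Φ (P 2)
    rw [← h2, ← kochHalf_two_mul n]; congr 1; ring
  · change kochHalf (n + 1) (3 * (2 * j + 1) + 2) = Φ (modelSplit ε (P 2) (P 3))
    rw [← h.splitPoint_eq, ← h2, ← h3, ← kochHalf_two_mul_add_one]; congr 1; ring
  · change kochHalf (n + 1) (3 * (2 * j + 1) + 3) = Φ (P 3)
    rw [← h3, ← kochHalf_two_mul n]; congr 1; ring

/-- The models of the vertices of the triangle in the initial region. -/
def startPoints : Fin 4 → ℝ × ℝ := ![(1 / 3, 0), (-1 / 6, -1 / 2), (-1 / 6, 1 / 2), (1 / 3, 0)]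

/-- The models of the four polygon vertices in a dart. -/
def dartPoints : Fin 4 → ℝ × ℝ := ![(0, -1), (1 / 2, -1 / 2), (1 / 2, 1 / 2), (0, 1)]

/-- The models of the four polygon vertices in a triangle, from the acute end to the right angle. -/
def trianglePoints : Fin 4 → ℝ × ℝ := ![(1, 0), (1 / 2, 1 / 2), (1 / 2, 3 / 2), (0, 1)]

/-- The models of the four polygon vertices in a triangle, from the right angle to the acute end. -/
def trianglePointsRev : Fin 4 → ℝ × ℝ := ![(0, 1), (1 / 2, 3 / 2), (1 / 2, 1 / 2), (1, 0)]

/-- `U` is one of the four kinds of cells that occur in the construction. -/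
def IsRegionCell (n j : ℕ) (U : Set ℂ) : Prop :=
  IsCell n j 1 modelStart startPoints U ∨ IsCell n j 1 modelDart dartPoints U ∨
    IsCell n j (-1) modelTriangle trianglePoints U ∨ IsCell n j 1 modelTriangle trianglePointsRev U

/-- `V` is a region that arises from the region `U` in iteration `k`. -/
def IsChild (k : ℕ) (U V : Set ℂ) : Prop :=
  ∃ R, IsLargestRhombus (1 / √3) k (closure U) R ∧ ∃ z ∈ U \ R, V = connectedComponentIn (U \ R) z

theorem abs_pos_of_eq {n : ℕ} {p : ℝ} (hp : |p| = √3 * (1 / √3) ^ n) : 0 < |p| := by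
  rw [hp]; positivity

theorem isOpen_image_childMap {x y : ℝ} {e f : ℤˣ} {S : Set (ℝ × ℝ)} (h : IsOpen S) :
    IsOpen (childMap x y e f '' S) := (childMap x y e f).isOpenMap _ h

theorem isPreconnected_image_childMap {x y : ℝ} {e f : ℤˣ} {S : Set (ℝ × ℝ)}
    (h : IsPreconnected S) : IsPreconnected (childMap x y e f '' S) :=
  h.image _ (childMap x y e f).continuous.continuousOn

/-! ### The four splitting rules -/

theorem IsCell.exists_children_start {n j : ℕ} {U : Set ℂ}
    (hU : IsCell n j 1 modelStart startPoints U) :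
    ∃ V W, IsCell (n + 1) (2 * j) 1 modelDart dartPoints V ∧
      IsCell (n + 1) (2 * j + 1) 1 modelDart dartPoints W ∧
      ∀ X, IsChild (n + 1) U X ↔ X = V ∨ X = W := by
  obtain ⟨c, p, Φ, h, hp, rfl, hP⟩ := hU
  refine ⟨_, _,
    h.isCell_child (P := dartPoints) hp 0 0 (-1) (-1) (by decide) modelDart
      (h.kochHalf_left hP) ?_,
    h.isCell_child (P := dartPoints) hp 0 0 1 1 (by decide) modelDart
      (h.kochHalf_right hP) ?_,
    h.children_eq (abs_pos_of_eq hp) (abs_units_mul 1 p) isUniqueLargest_start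
      modelStart_sdiff (isOpen_image_childMap isOpen_modelDart)
      (isOpen_image_childMap isOpen_modelDart)
      (isPreconnected_image_childMap isPreconnected_modelDart)
      (isPreconnected_image_childMap isPreconnected_modelDart) (nonempty_modelDart.image _)
      (nonempty_modelDart.image _) disjoint_children_start⟩
  · intro i
    fin_cases i <;> ext <;> simp [childMap_apply, dartPoints, startPoints, modelSplit] <;>
      norm_num
  · intro i
    fin_cases i <;> ext <;> simp [childMap_apply, dartPoints, startPoints, modelSplit] <;>
      norm_num

theorem IsCell.exists_children_dart {n j : ℕ} {U : Set ℂ}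
    (hU : IsCell n j 1 modelDart dartPoints U) :
    ∃ V W, IsCell (n + 1) (2 * j) (-1) modelTriangle trianglePoints V ∧
      IsCell (n + 1) (2 * j + 1) 1 modelTriangle trianglePointsRev W ∧
      ∀ X, IsChild (n + 1) U X ↔ X = V ∨ X = W := by
  obtain ⟨c, p, Φ, h, hp, rfl, hP⟩ := hU
  refine ⟨_, _,
    h.isCell_child (P := trianglePoints) hp 0 0 1 (-1) (by decide) modelTriangle
      (h.kochHalf_left hP) ?_,
    h.isCell_child (P := trianglePointsRev) hp 0 0 1 1 (by decide) modelTriangle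
      (h.kochHalf_right hP) ?_,
    h.children_eq (abs_pos_of_eq hp) (abs_units_mul 1 p) isUniqueLargest_dart
      modelDart_sdiff (isOpen_image_childMap isOpen_modelTriangle)
      (isOpen_image_childMap isOpen_modelTriangle)
      (isPreconnected_image_childMap isPreconnected_modelTriangle)
      (isPreconnected_image_childMap isPreconnected_modelTriangle) (nonempty_modelTriangle.image _)
      (nonempty_modelTriangle.image _) disjoint_children_dart⟩
  · intro i
    fin_cases i <;> ext <;> simp [childMap_apply, dartPoints, trianglePoints, modelSplit] <;>
      norm_num
  · intro i
    fin_cases i <;> ext <;> simp [childMap_apply, dartPoints, trianglePointsRev, modelSplit] <;>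
      norm_num

theorem IsCell.exists_children_triangle {n j : ℕ} {U : Set ℂ}
    (hU : IsCell n j (-1) modelTriangle trianglePoints U) :
    ∃ V W, IsCell (n + 1) (2 * j) (-1) modelTriangle trianglePoints V ∧
      IsCell (n + 1) (2 * j + 1) 1 modelDart dartPoints W ∧
      ∀ X, IsChild (n + 1) U X ↔ X = V ∨ X = W := by
  obtain ⟨c, p, Φ, h, hp, rfl, hP⟩ := hU
  refine ⟨_, _,
    h.isCell_child (P := trianglePoints) hp 1 1 (-1) (-1) (by decide) modelTriangle
      (h.kochHalf_left hP) ?_,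
    h.isCell_child (P := dartPoints) hp (1 / 3) 1 (-1) 1 (by decide) modelDart
      (h.kochHalf_right hP) ?_,
    h.children_eq (abs_pos_of_eq hp) (abs_units_mul (-1) p) isUniqueLargest_triangle
      (modelTriangle_sdiff (-1)) (isOpen_image_childMap isOpen_modelTriangle)
      (isOpen_image_childMap isOpen_modelDart)
      (isPreconnected_image_childMap isPreconnected_modelTriangle)
      (isPreconnected_image_childMap isPreconnected_modelDart) (nonempty_modelTriangle.image _)
      (nonempty_modelDart.image _) (disjoint_children_triangle (-1))⟩
  · intro i
    fin_cases i <;> ext <;> simp [childMap_apply, trianglePoints, modelSplit] <;>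
      norm_num
  · intro i
    fin_cases i <;> ext <;> simp [childMap_apply, dartPoints, trianglePoints, modelSplit] <;>
      norm_num

theorem IsCell.exists_children_triangleRev {n j : ℕ} {U : Set ℂ}
    (hU : IsCell n j 1 modelTriangle trianglePointsRev U) :
    ∃ V W, IsCell (n + 1) (2 * j) 1 modelDart dartPoints V ∧
      IsCell (n + 1) (2 * j + 1) 1 modelTriangle trianglePointsRev W ∧
      ∀ X, IsChild (n + 1) U X ↔ X = V ∨ X = W := by
  obtain ⟨c, p, Φ, h, hp, rfl, hP⟩ := hU
  refine ⟨_, _,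
    h.isCell_child (P := dartPoints) hp (1 / 3) 1 1 1 (by decide) modelDart
      (h.kochHalf_left hP) ?_,
    h.isCell_child (P := trianglePointsRev) hp 1 1 (-1) (-1) (by decide) modelTriangle
      (h.kochHalf_right hP) ?_,
    -- The dissection lists the triangle first, but the polygon passes through the dart first.
    fun X =>
      (h.children_eq (abs_pos_of_eq hp) (abs_units_mul 1 p) isUniqueLargest_triangle
      (modelTriangle_sdiff 1) (isOpen_image_childMap isOpen_modelTriangle)
      (isOpen_image_childMap isOpen_modelDart)
      (isPreconnected_image_childMap isPreconnected_modelTriangle)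
      (isPreconnected_image_childMap isPreconnected_modelDart) (nonempty_modelTriangle.image _)
      (nonempty_modelDart.image _) (disjoint_children_triangle 1) X).trans or_comm⟩
  · intro i
    fin_cases i <;> ext <;> simp [childMap_apply, dartPoints, trianglePointsRev, modelSplit] <;>
      norm_num
  · intro i
    fin_cases i <;> ext <;> simp [childMap_apply, trianglePointsRev, modelSplit] <;>
      norm_num

theorem IsRegionCell.exists_children {n j : ℕ} {U : Set ℂ} (hU : IsRegionCell n j U) :
    ∃ V W, IsRegionCell (n + 1) (2 * j) V ∧ IsRegionCell (n + 1) (2 * j + 1) W ∧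
      ∀ X, IsChild (n + 1) U X ↔ X = V ∨ X = W := by
  rcases hU with hU | hU | hU | hU
  · obtain ⟨V, W, hV, hW, h⟩ := hU.exists_children_start
    exact ⟨V, W, Or.inr (Or.inl hV), Or.inr (Or.inl hW), h⟩
  · obtain ⟨V, W, hV, hW, h⟩ := hU.exists_children_dart
    exact ⟨V, W, Or.inr (Or.inr (Or.inl hV)), Or.inr (Or.inr (Or.inr hW)), h⟩
  · obtain ⟨V, W, hV, hW, h⟩ := hU.exists_children_triangle
    exact ⟨V, W, Or.inr (Or.inr (Or.inl hV)), Or.inr (Or.inl hW), h⟩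
  · obtain ⟨V, W, hV, hW, h⟩ := hU.exists_children_triangleRev
    exact ⟨V, W, Or.inr (Or.inl hV), Or.inr (Or.inr (Or.inr hW)), h⟩

/-! ### The initial region -/

/-- The frame of the initial region. -/
def startFrame : ℝ × ℝ ≃ₜ ℂ :=
  (Homeomorph.prodComm ℝ ℝ).trans
    (((Homeomorph.mulLeft₀ √3 (by positivity)).prodCongr
      (Homeomorph.mulLeft₀ 3 (by norm_num))).trans Complex.equivRealProdCLM.symm.toHomeomorph)

theorem startFrame_apply (z : ℝ × ℝ) : startFrame z = ⟨√3 * z.2, 3 * z.1⟩ := by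
  apply Complex.ext <;> simp [startFrame]

theorem isFrame_startFrame : IsFrame 0 0 √3 (((1 : ℤˣ) : ℤ) * √3) startFrame := by
  intro z
  rw [startFrame_apply]
  simp

theorem convex_modelStart : Convex ℝ modelStart := by
  intro z hz w hw a b ha hb hab
  simp only [modelStart, mem_ofPred_eq, Prod.fst_add, Prod.snd_add, Prod.smul_fst,
    Prod.smul_snd, smul_eq_mul] at *
  have h1 : |a * z.1 + b * w.1| ≤ a * |z.1| + b * |w.1| := by
    simpa [abs_mul, abs_of_nonneg ha, abs_of_nonneg hb] using abs_add_le (a * z.1) (b * w.1)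
  have h2 : |a * z.2 + b * w.2| ≤ a * |z.2| + b * |w.2| := by
    simpa [abs_mul, abs_of_nonneg ha, abs_of_nonneg hb] using abs_add_le (a * z.2) (b * w.2)
  rcases ha.eq_or_lt with rfl | ha
  · obtain rfl : b = 1 := by linarith
    linarith
  · nlinarith [mul_lt_mul_of_pos_left hz ha, mul_le_mul_of_nonneg_left hw.le hb]

theorem interior_horizontalRhombus :
    interior (horizontalRhombus (1 / √3) 0 1) = startFrame '' modelStart := by
  have h : horizontalRhombus (1 / √3) 0 1 = startFrame '' closure modelStart := by
    ext w
    obtain ⟨z, rfl⟩ := startFrame.surjective w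
    rw [startFrame.injective.mem_set_image, closure_modelStart, startFrame_apply]
    simp only [horizontalRhombus, mem_ofPred_eq, Complex.zero_re, Complex.zero_im, sub_zero,
      abs_mul, abs_of_pos (show (0 : ℝ) < 3 by norm_num), abs_of_pos (show 0 < √3 by positivity)]
    rw [← mul_assoc, one_div_mul_cancel (by positivity), one_mul, add_comm]
  have hne : (interior modelStart).Nonempty := by
    rw [isOpen_modelStart.interior_eq]
    exact ⟨(0, 0), by simp [modelStart]⟩
  rw [h, ← startFrame.image_interior,
    convex_modelStart.interior_closure_eq_interior_of_nonempty_interior hne,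
    isOpen_modelStart.interior_eq]

theorem exp_two_pi_div_three :
    Complex.exp (2 * Real.pi / 3 * Complex.I) = ⟨-1 / 2, √3 / 2⟩ := by
  have h1 : (2 * (Real.pi : ℂ) / 3 * Complex.I) =
      ((Real.pi - Real.pi / 3 : ℝ) : ℂ) * Complex.I := by
    push_cast; ring
  rw [h1, Complex.exp_mul_I, ← Complex.ofReal_cos, ← Complex.ofReal_sin, Real.cos_pi_sub,
    Real.sin_pi_sub, Real.cos_pi_div_three, Real.sin_pi_div_three]
  apply Complex.ext <;> simp; norm_num

theorem isRegionCell_start :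
    IsRegionCell 0 0 (interior (horizontalRhombus (1 / √3) 0 1)) := by
  refine Or.inl ⟨0, √3, startFrame, isFrame_startFrame, ?_, interior_horizontalRhombus, ?_⟩
  · simp
  · have h3 := sqrt_three_mul_self
    intro i
    simp only [kochHalf, kochVertex, exp_two_pi_div_three, startFrame_apply]
    fin_cases i <;> apply Complex.ext <;> simp [startPoints, pow_succ] <;> grind

/-! ### The stages -/

theorem emptyRegions_succ (k : ℕ) : emptyRegions (1 / √3) (k + 1) =
    {V | ∃ U ∈ emptyRegions (1 / √3) k, IsChild (k + 1) U V} := rfl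

theorem exists_cells (n : ℕ) : ∃ cell : ℕ → Set ℂ,
    emptyRegions (1 / √3) n = cell '' Iio (2 ^ n) ∧
      ∀ j < 2 ^ n, IsRegionCell n j (cell j) := by
  induction n with
  | zero =>
    refine ⟨fun _ => interior (horizontalRhombus (1 / √3) 0 1), ?_, ?_⟩
    · ext U
      simp [emptyRegions]
    · intro j hj
      obtain rfl : j = 0 := by simpa using hj
      exact isRegionCell_start
  | succ n ih =>
    obtain ⟨cell, hcell, hc⟩ := ih
    have hch := fun j hj => (hc j hj).exists_children
    choose! V W hV hW hVW using hch
    refine ⟨fun j => if j % 2 = 0 then V (j / 2) else W (j / 2), ?_, ?_⟩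
    · ext X
      rw [emptyRegions_succ, hcell]
      simp only [mem_ofPred_eq, mem_image, mem_Iio, exists_exists_and_eq_and]
      constructor
      · rintro ⟨j, hj, hX⟩
        rcases (hVW j hj X).1 hX with rfl | rfl
        · exact ⟨2 * j, by rw [pow_succ]; omega, by simp⟩
        · refine ⟨2 * j + 1, by rw [pow_succ]; omega, ?_⟩
          have h1 : (2 * j + 1) % 2 = 1 := by omega
          have h2 : (2 * j + 1) / 2 = j := by omega
          simp [h1, h2]
      · rintro ⟨j, hj, rfl⟩
        rw [pow_succ] at hj
        refine ⟨j / 2, by omega, ?_⟩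
        rw [hVW _ (by omega)]
        split_ifs
        · exact Or.inl rfl
        · exact Or.inr rfl
    · intro j hj
      rw [pow_succ] at hj
      obtain ⟨i, rfl | rfl⟩ := Nat.even_or_odd' j
      · have h1 : 2 * i / 2 = i := by omega
        simpa [h1] using hV i (by omega)
      · have h1 : (2 * i + 1) % 2 = 1 := by omega
        have h2 : (2 * i + 1) / 2 = i := by omega
        simpa [h1, h2] using hW i (by omega)

theorem stage_succ_subset (a : ℝ) (k : ℕ) : stage a (k + 1) ⊆ stage a k := by
  refine iUnion₂_subset fun V hV => ?_
  obtain ⟨U, hU, R, -, z, -, rfl⟩ := hV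
  refine subset_iUnion₂_of_subset U hU (closure_mono ?_)
  exact (connectedComponentIn_subset _ _).trans sdiff_subset

theorem stage_antitone (a : ℝ) : Antitone (stage a) :=
  antitone_nat_of_succ_le (stage_succ_subset a)

theorem isClosed_stage (n : ℕ) : IsClosed (stage (1 / √3) n) := by
  obtain ⟨cell, hcell, -⟩ := exists_cells n
  rw [stage, hcell]
  exact ((finite_Iio _).image _).isClosed_biUnion fun _ _ => isClosed_closure

/-! ### Size of the cells and their Koch vertices -/

theorem IsFrame.dist_le {n : ℕ} {c : ℂ} {p q : ℝ} {Φ : ℝ × ℝ ≃ₜ ℂ} (h : IsFrame n c p q Φ)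
    (hpq : |q| = |p|) (z w : ℝ × ℝ) :
    dist (Φ z) (Φ w) ≤ |p| * (2 * |z.1 - w.1| + |z.2 - w.2|) := by
  have h2 : √3 ≤ 2 := by rw [Real.sqrt_le_left (by norm_num)]; norm_num
  have key : |√3 * p * (z.1 - w.1)| + |q * (z.2 - w.2)| ≤
      |p| * (2 * |z.1 - w.1| + |z.2 - w.2|) := by
    rw [abs_mul, abs_mul, abs_mul, hpq, abs_of_nonneg (Real.sqrt_nonneg 3)]
    have : 0 ≤ |p| * |z.1 - w.1| := by positivity
    nlinarith
  rw [dist_eq_norm]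
  refine (Complex.norm_le_abs_re_add_abs_im _).trans (le_trans (le_of_eq ?_) key)
  rw [h, h]
  split_ifs
  · simp only [Complex.sub_re, Complex.sub_im, add_sub_add_left_eq_sub, ← mul_sub]
  · simp only [Complex.sub_re, Complex.sub_im, add_sub_add_left_eq_sub, ← mul_sub]
    rw [add_comm]

theorem IsCell.closure_spec {n j : ℕ} {ε : ℤˣ} {S : Set (ℝ × ℝ)} {P : Fin 4 → ℝ × ℝ} {U : Set ℂ}
    (h : IsCell n j ε S P U) (h0 : P 0 ∈ closure S) (h3 : P 3 ∈ closure S)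
    (hS : ∀ z ∈ closure S, |z.1| ≤ 1 ∧ |z.2| ≤ 2) :
    kochHalf n (3 * j) ∈ closure U ∧ kochHalf n (3 * (j + 1)) ∈ closure U ∧
      ∀ z ∈ closure U, dist z (kochHalf n (3 * j)) ≤ 16 * (1 / √3) ^ n := by
  obtain ⟨c, p, Φ, hΦ, hp, rfl, hP⟩ := h
  have e0 : kochHalf n (3 * j) = Φ (P 0) := hP 0
  have e3 : kochHalf n (3 * (j + 1)) = Φ (P 3) := hP 3
  rw [← Φ.image_closure, e0, e3]
  refine ⟨mem_image_of_mem _ h0, mem_image_of_mem _ h3, ?_⟩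
  rintro _ ⟨z, hz, rfl⟩
  refine (hΦ.dist_le (abs_units_mul _ _) z (P 0)).trans ?_
  -- Coordinate differences are at most `2` and `4`, giving `2 * 2 + 4 = 8`; with `|p| ≤ 2 * (1 /
  -- √3) ^ n` the constant is `16`.
  have hb : 2 * |z.1 - (P 0).1| + |z.2 - (P 0).2| ≤ 8 := by
    linarith [abs_sub z.1 (P 0).1, abs_sub z.2 (P 0).2, (hS z hz).1, (hS z hz).2,
      (hS _ h0).1, (hS _ h0).2]
  have h2 : √3 ≤ 2 := by rw [Real.sqrt_le_left (by norm_num)]; norm_num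
  have h5 : |p| ≤ 2 * (1 / √3) ^ n := by rw [hp]; gcongr
  calc _ ≤ (2 * (1 / √3) ^ n) * 8 := by gcongr
    _ = _ := by ring

theorem IsRegionCell.closure_spec {n j : ℕ} {U : Set ℂ} (h : IsRegionCell n j U) :
    kochHalf n (3 * j) ∈ closure U ∧ kochHalf n (3 * (j + 1)) ∈ closure U ∧
      ∀ z ∈ closure U, dist z (kochHalf n (3 * j)) ≤ 16 * (1 / √3) ^ n := by
  have hT : ∀ z ∈ closure modelTriangle, |z.1| ≤ 1 ∧ |z.2| ≤ 2 := by
    rw [closure_modelTriangle]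
    rintro ⟨x, y⟩ ⟨h1, h2, h3⟩
    simp only [abs_le] at *
    refine ⟨⟨?_, ?_⟩, ?_, ?_⟩ <;> linarith
  rcases h with h | h | h | h
  · refine h.closure_spec ?_ ?_ ?_ <;> rw [closure_modelStart]
    · simp [startPoints]
    · simp [startPoints]
    · rintro ⟨x, y⟩ hz
      simp only [mem_ofPred_eq] at *
      constructor <;> linarith [abs_nonneg x, abs_nonneg y]
  · refine h.closure_spec ?_ ?_ ?_ <;> rw [closure_modelDart]
    · simp [dartPoints]
    · simp [dartPoints]
    · rintro ⟨x, y⟩ ⟨h1, h2⟩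
      simp only at *
      have := abs_nonneg y
      constructor
      · rw [abs_le]; constructor <;> linarith
      · linarith
  · refine h.closure_spec ?_ ?_ hT <;> rw [closure_modelTriangle] <;> simp [trianglePoints]
    norm_num
  · refine h.closure_spec ?_ ?_ hT <;> rw [closure_modelTriangle] <;> simp [trianglePointsRev]
    norm_num

theorem kochHalf_mem_stage {n j : ℕ} (hj : j ≤ 2 ^ n) :
    kochHalf n (3 * j) ∈ stage (1 / √3) n := by
  obtain ⟨cell, hcell, hc⟩ := exists_cells n
  have hmem : ∀ j < 2 ^ n, closure (cell j) ⊆ stage (1 / √3) n := fun j hj =>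
    subset_iUnion₂_of_subset (cell j) (hcell ▸ mem_image_of_mem _ hj) le_rfl
  rcases hj.lt_or_eq with h | h
  · exact hmem j h (hc j h).closure_spec.1
  -- The index `2 ^ n` starts no cell; its vertex is the far end of the last one.
  · obtain ⟨i, rfl⟩ : ∃ i, j = i + 1 := Nat.exists_eq_succ_of_ne_zero (by rw [h]; positivity)
    exact hmem i (by omega) (hc i (by omega)).closure_spec.2.1

theorem exists_dist_le_of_mem_stage {n : ℕ} {z : ℂ} (hz : z ∈ stage (1 / √3) n) :
    ∃ j < 2 ^ n, dist z (kochHalf n (3 * j)) ≤ 16 * (1 / √3) ^ n := by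
  obtain ⟨cell, hcell, hc⟩ := exists_cells n
  obtain ⟨U, hU, hzU⟩ := mem_iUnion₂.1 hz
  rw [hcell] at hU
  obtain ⟨j, hj, rfl⟩ := hU
  exact ⟨j, hj, (hc j hj).closure_spec.2.2 z hzU⟩

end Gasket

end

/-! ### The gasket and the Koch curve coincide -/

theorem mainTheorem2 :
    ∃ g : C(unitInterval, ℂ),
      TendstoUniformly (fun (k : ℕ) (t : unitInterval) => Gasket.kochPolygon k (t : ℝ)) g
        Filter.atTop ∧
      Gasket.gasket (1 / Real.sqrt 3) = Set.range g := by
  obtain ⟨g, hg, hnode⟩ := Gasket.exists_kochCurve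
  refine ⟨g, hg, Set.Subset.antisymm ?_ ?_⟩
  · intro z hz
    rw [← (isCompact_range g.continuous).isClosed.closure_eq, Metric.mem_closure_iff]
    intro ε hε
    have hlim : Filter.Tendsto (fun k : ℕ => (16 * (1 / 3) ^ k : ℝ)) Filter.atTop
        (nhds (16 * 0)) :=
      (tendsto_pow_atTop_nhds_zero_of_lt_one (by norm_num) (by norm_num)).const_mul _
    rw [mul_zero] at hlim
    -- The condition `1 ≤ k` is needed because the gasket intersects the stages from iteration `1`
    -- on.
    obtain ⟨k, hk, hk1⟩ :=
      ((hlim.eventually_lt_const hε).and (Filter.eventually_ge_atTop 1)).exists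
    obtain ⟨j, hj, hd⟩ := Gasket.exists_dist_le_of_mem_stage
      (Set.mem_iInter₂.1 hz (2 * k) (by omega))
    rw [← Gasket.kochVertex_eq_kochHalf, pow_mul (1 / Real.sqrt 3), div_pow, sq, sq,
      Gasket.sqrt_three_mul_self, one_mul] at hd
    rw [pow_mul] at hj
    have hj' : (j : ℝ) ≤ 4 ^ k := by exact_mod_cast hj.le
    refine ⟨_, ⟨⟨((3 * j : ℕ) : ℝ) / (3 * 4 ^ k), by positivity, ?_⟩, hnode k (3 * j) _ rfl⟩,
      hd.trans_lt hk⟩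
    rw [div_le_one (by positivity)]
    push_cast
    linarith
  · rintro _ ⟨t, rfl⟩
    refine Set.mem_iInter₂.2 fun n _ => ?_
    have ht0 : (0 : ℝ) ≤ t := t.2.1
    have hmem : ∀ k : ℕ, (⌊(t : ℝ) * 4 ^ k⌋₊ : ℝ) ≤ 4 ^ k := fun k =>
      (Nat.floor_le (by positivity)).trans (mul_le_of_le_one_left (by positivity) t.2.2)
    -- These parameters belong to vertices whose index is a multiple of `3`, the ends of arcs of
    -- cells.
    let s : ℕ → unitInterval := fun k => ⟨⌊(t : ℝ) * 4 ^ k⌋₊ / 4 ^ k, by positivity,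
      div_le_one_of_le₀ (hmem k) (by positivity)⟩
    have hs : Filter.Tendsto s Filter.atTop (nhds t) := by
      rw [tendsto_subtype_rng]
      exact (tendsto_nat_floor_mul_div_atTop ht0).comp
        (tendsto_pow_atTop_atTop_of_one_lt (by norm_num : (1 : ℝ) < 4))
    refine (Gasket.isClosed_stage n).mem_of_tendsto ((g.continuous.tendsto t).comp hs) ?_
    filter_upwards [Filter.eventually_ge_atTop n] with k hk
    refine Gasket.stage_antitone _ (show n ≤ 2 * k by omega) ?_
    rw [Function.comp_apply, hnode k (3 * ⌊(t : ℝ) * 4 ^ k⌋₊) (s k)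
      (by push_cast; rw [mul_div_mul_left _ _ (by norm_num)]), Gasket.kochVertex_eq_kochHalf]
    apply Gasket.kochHalf_mem_stage
    rw [pow_mul]
    exact_mod_cast hmem k
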